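/- Let $\mathbb{T}=\mathbb{R}/\mathbb{Z}$ and let $\xi=(\xi_n)_{n\in\mathbb{Z}}$ be a (jointly Gaussian) complex Gaussian sequence on a probability space with $\mathbb{E}(\xi_n)=0$, $\mathbb{E}(|\xi_n|^2)=1$, $\mathbb{E}(\xi_n\xi_m)=0$ and $\mathbb{E}(\xi_n\overline{\xi_m})=\gamma(n-m)$ for all $n,m\in\mathbb{Z}$. Assume that for some $b\ge 0$ the bi-infinite matrix $(a_{nm})_{n,m\in\mathbb{Z}}$ given by $a_{nm}=|\gamma(n-m)|\,|nm|^{-b}$ for $n\neq 0$ and $m\neq 0$, and $a_{nm}=0$ if $n=0$ or $m=0$, defines a bounded operator on $\ell^2(\mathbb{Z})$. Let $f\in L^2(\mathbb{T})$, with Fourier coefficients $\hat f(n)=\int_{\mathbb{T}} f(t)e^{-2\pi i n t}\,dt$, satisfy $$\sum_{|n|\ge 2}\frac{\left(\sum_{|k|\ge |n|}|\hat f(k)|^2|k|^{2b}\right)^{1/2}}{|n|(\log|n|)^{1/2}}<\infty .$$ Then for every $t\in\mathbb{T}$ the series $S(t)=\sum_{n\in\mathbb{Z}}\hat f(n)\,\xi_n\,e^{2\pi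 i n t}$ converges (unconditionally) in $L^2(\mathbb{P})$, and the process $(S(t))_{t\in\mathbb{T}}$ has bounded paths almost surely (that is, it has a version for which $\sup_{t\in\mathbb{T}}|S(t)|<\infty$ almost surely). In particular, if moreover $f$ is continuous and $\mu$ is the spectral measure of $\xi$, i.e. the Borel probability measure on $\mathbb{T}$ with $\gamma(k)=\int_{\mathbb{T}} e^{2\pi i k t}\,d\mu(t)$ for all $k\in\mathbb{Z}$, then $f\in\mathscr{P}(\mu)$. Here $\mathscr{P}(\mu)$ is the class of continuous functions $f$ on $\mathbb{T}$ for which the centred complex Gaussian process $X_f=(X_f(t))_{t\in\mathbb{T}}$ with $\mathbb{E}(X_f(t)X_f(s))=0$ and $\mathbb{E}(X_f(t)\overline{X_f(s)})=\int_{\mathbb{T}} f(t+u)\overline{f(s+u)}\,d\mu(u)$ for all $t,s\in\mathbb{T}$ has almost surely bounded paths (for some version). -/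

import Mathlib

open MeasureTheory ProbabilityTheory Filter Topology AddCircle
open scoped ENNReal ComplexConjugate

noncomputable section

/-- A centred, circularly symmetric complex Gaussian process `X` with covariance `C`:
the process is (jointly) Gaussian, has mean zero, `E (X s * X t) = 0`
and `E (X s * conj (X t)) = C s t`. -/
structure IsCircularGaussian {ι Ω : Type*} [MeasurableSpace Ω] (P : Measure Ω)
    (X : ι → Ω → ℂ) (C : ι → ι → ℂ) : Prop where
  gaussian : IsGaussianProcess X P
  mean_zero : ∀ s, ∫ ω, X s ω ∂P = 0
  pseudo_zero : ∀ s t, ∫ ω, X s ω * X t ω ∂P = 0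
  covariance : ∀ s t, ∫ ω, X s ω * conj (X t ω) ∂P = C s t

/-- A stationary complex Gaussian sequence with mean zero, unit variance,
`E (ξ n * ξ m) = 0` and `E (ξ n * conj (ξ m)) = γ (n - m)`. -/
structure IsStationaryGaussian {Ω : Type*} [MeasurableSpace Ω] (P : Measure Ω)
    (ξ : ℤ → Ω → ℂ) (γ : ℤ → ℂ) : Prop where
  circular : IsCircularGaussian P ξ (fun n m => γ (n - m))
  unit_variance : γ 0 = 1

/-- `μ` is the spectral measure of a sequence with covariance function `γ`. -/
def IsSpectralMeasure (μ : Measure UnitAddCircle) (γ : ℤ → ℂ) : Prop :=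
  IsProbabilityMeasure μ ∧ ∀ k : ℤ, γ k = ∫ t, fourier k t ∂μ

/-- The paths `t ↦ X t ω` are bounded for almost every `ω`. -/
def AEBoundedPaths {ι Ω : Type*} [MeasurableSpace Ω] (P : Measure Ω)
    (X : ι → Ω → ℂ) : Prop :=
  ∀ᵐ ω ∂P, ∃ M : ℝ, ∀ t, ‖X t ω‖ ≤ M

/-- The class of continuous functions `f` on the circle for which the centred complex Gaussian
process `X_f` with `E (X_f t * conj (X_f s)) = ∫ f (t + u) * conj (f (s + u)) dμ(u)`
(unique in law) has a version with almost surely bounded paths. -/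
def PisierClass (μ : Measure UnitAddCircle) : Set C(UnitAddCircle, ℂ) :=
  {f | ∃ (Ω : Type) (_ : MeasurableSpace Ω) (P : Measure Ω) (X : UnitAddCircle → Ω → ℂ),
    IsCircularGaussian P X (fun t s => ∫ u, f (t + u) * conj (f (s + u)) ∂μ) ∧
      AEBoundedPaths P X}

/-- The bi-infinite matrix `a n m = |γ (n - m)| |n m| ^ (-b)` for `n ≠ 0` and `m ≠ 0`;
the row and the column of index `0` vanish. -/
def weightedCovMatrix (γ : ℤ → ℂ) (b : ℝ) (n m : ℤ) : ℝ :=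
  if n = 0 ∨ m = 0 then 0 else ‖γ (n - m)‖ * |(n : ℝ) * (m : ℝ)| ^ (-b)

/-- The bi-infinite matrix `a` is the matrix of a bounded operator on `ℓ²(ℤ)`. -/
def IsBoundedMatrix (a : ℤ → ℤ → ℝ) : Prop :=
  ∃ A : lp (fun _ : ℤ => ℂ) 2 →L[ℂ] lp (fun _ : ℤ => ℂ) 2,
    ∀ n m : ℤ, A (lp.single 2 m (1 : ℂ)) n = (a n m : ℂ)

/-- The tail `∑_{|k| ≥ |n|} |c k|² |k|^{2b}`, with values in `[0, ∞]`. -/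
def weightedTail (c : ℤ → ℂ) (b : ℝ) (n : ℤ) : ℝ≥0∞ :=
  ∑' k : {k : ℤ // |n| ≤ |k|}, ENNReal.ofReal (‖c k‖ ^ 2 * |((k : ℤ) : ℝ)| ^ (2 * b))

/-- The sum `∑_{|n| ≥ 2} (∑_{|k| ≥ |n|} |c k|² |k|^{2b})^{1/2} / (|n| (log |n|)^{1/2})`,
with values in `[0, ∞]`. -/
def entropySum (c : ℤ → ℂ) (b : ℝ) : ℝ≥0∞ :=
  ∑' n : {n : ℤ // 2 ≤ |n|}, (weightedTail c b n) ^ (1 / 2 : ℝ) /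
    ENNReal.ofReal (|((n : ℤ) : ℝ)| * Real.sqrt (Real.log |((n : ℤ) : ℝ)|))

/-- `S` is a version of the process of `L²`-sums `S t = ∑_{n ∈ ℤ} c n * ξ n * e^{2πint}`:
for each `t` the finite partial sums converge (unconditionally) to `S t` in `L²(P)`. -/
def IsRandomFourierSum {Ω : Type*} [MeasurableSpace Ω] (P : Measure Ω)
    (c : ℤ → ℂ) (ξ : ℤ → Ω → ℂ) (S : UnitAddCircle → Ω → ℂ) : Prop :=
  ∀ t, MemLp (S t) 2 P ∧
    Tendsto (fun F : Finset ℤ =>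
      eLpNorm (fun ω => (∑ n ∈ F, c n * ξ n ω * fourier n t) - S t ω) 2 P) atTop (𝓝 0)

end

/-! Testing the matrix on the vector `‖a n‖ |n|^b` turns its boundedness into `‖∑ a n η n‖₂² ≤ K² ∑
|n|^{2b} ‖a n‖²` (weight `1` at `n = 0`) for every sequence `η` with covariance `γ`
(`IsBoundedMatrix.exists_eLpNorm_sum_le`). This applies both to `ξ` in `L²(P)` and to the characters
in `L²(μ)`.

Boundedness comes from doubly exponential blocks `2^{2^j} ≤ |n| < 2^{2^{j+1}}`. A random
trigonometric polynomial of degree `N` and pointwise standard deviation at most `σ` has sup norm of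
order `σ √(log N)`, by a union bound over a grid of polynomially many points. Here `log N` is of
order `2^j`, and Cauchy condensation applied twice turns the entropy condition into `∑ 2^{j/2} σ j <
∞`. By Borel–Cantelli the sup norms of the blocks are almost surely summable
(`ae_summable_norm_trigPoly`).

For continuous `f`, the process `S` has the law of `X_f` once the partial Fourier sums of `u ↦ f (t
+ u)` converge to it in `L²(μ)` for every `t` (`tendsto_eLpNorm_fourier_translate`). The weighted
bound makes them Cauchy uniformly in `t`; the limit is identified by averaging over `t`, which
replaces `μ` by Haar measure, and by continuity in `t`. -/

/-- The weight `|n| ^ (2 b)`, replaced by `1` at `n = 0`. -/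
noncomputable def sobolevWeight (b : ℝ) (n : ℤ) : ℝ := if n = 0 then 1 else |(n : ℝ)| ^ (2 * b)

lemma sobolevWeight_pos (b : ℝ) (n : ℤ) : 0 < sobolevWeight b n := by
  unfold sobolevWeight
  split_ifs with h
  · exact one_pos
  · exact Real.rpow_pos_of_pos (abs_pos.2 (by exact_mod_cast h)) _

/-- The quadratic form is `⟪v, A v⟫` for the finitely supported vector `v` with entries `x n`, hence
at most `‖A‖ ‖v‖²`. -/
lemma IsBoundedMatrix.exists_sum_le {a : ℤ → ℤ → ℝ} (h : IsBoundedMatrix a) :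
    ∃ C : ℝ, 0 ≤ C ∧ ∀ (F : Finset ℤ) (x : ℤ → ℝ),
      ∑ n ∈ F, ∑ m ∈ F, x n * x m * a n m ≤ C * ∑ n ∈ F, x n ^ 2 := by
  obtain ⟨A, hA⟩ := h
  refine ⟨‖A‖, norm_nonneg _, fun F x => ?_⟩
  set v : lp (fun _ : ℤ => ℂ) 2 := ∑ m ∈ F, lp.single 2 m ((x m : ℝ) : ℂ) with hv
  have hnorm : ‖v‖ ^ 2 = ∑ n ∈ F, x n ^ 2 := by
    have := lp.norm_sum_single (p := 2) (E := fun _ : ℤ => ℂ) (by norm_num)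
      (fun m => ((x m : ℝ) : ℂ)) F
    simpa [← hv] using this
  have hAv : ∀ n, A v n = ((∑ m ∈ F, x m * a n m : ℝ) : ℂ) := by
    intro n
    have h1 : ∀ m, lp.single 2 m ((x m : ℝ) : ℂ)
        = ((x m : ℝ) : ℂ) • (lp.single 2 m (1 : ℂ) : lp (fun _ : ℤ => ℂ) 2) := by
      intro m
      rw [← lp.single_smul]
      simp
    rw [hv]
    simp_rw [h1]
    rw [map_sum]
    simp only [map_smul, lp.coeFn_sum, Finset.sum_apply, lp.coeFn_smul, Pi.smul_apply, hA,
      smul_eq_mul]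
    push_cast
    rfl
  have hinner : inner ℂ v (A v) = ((∑ n ∈ F, ∑ m ∈ F, x n * x m * a n m : ℝ) : ℂ) := by
    nth_rewrite 1 [hv]
    rw [sum_inner]
    simp_rw [lp.inner_single_left, hAv]
    simp only [RCLike.inner_apply, Complex.conj_ofReal]
    push_cast
    refine Finset.sum_congr rfl fun n _ => ?_
    rw [Finset.sum_mul]
    exact Finset.sum_congr rfl fun m _ => by ring
  have h2 : ‖inner ℂ v (A v)‖ ≤ ‖v‖ * ‖A v‖ := norm_inner_le_norm _ _
  rw [hinner, Complex.norm_real] at h2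
  calc _ ≤ ‖v‖ * ‖A v‖ := (le_abs_self _).trans h2
    _ ≤ ‖v‖ * (‖A‖ * ‖v‖) := by gcongr; exact A.le_opNorm v
    _ = ‖A‖ * ‖v‖ ^ 2 := by ring
    _ = _ := by rw [hnorm]

lemma IsBoundedMatrix.exists_sum_norm_le {γ : ℤ → ℂ} {b : ℝ}
    (h : IsBoundedMatrix (weightedCovMatrix γ b)) :
    ∃ C : ℝ, 0 ≤ C ∧ ∀ (F : Finset ℤ) (a : ℤ → ℂ), 0 ∉ F →
      ∑ n ∈ F, ∑ m ∈ F, ‖a n‖ * ‖a m‖ * ‖γ (n - m)‖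
        ≤ C * ∑ n ∈ F, sobolevWeight b n * ‖a n‖ ^ 2 := by
  obtain ⟨C, hC, hF⟩ := h.exists_sum_le
  refine ⟨C, hC, fun F a h0 => ?_⟩
  have hne : ∀ n ∈ F, n ≠ 0 := fun n hn h => h0 (h ▸ hn)
  have hpos : ∀ n ∈ F, 0 < |(n : ℝ)| := fun n hn => abs_pos.2 (by exact_mod_cast hne n hn)
  convert! hF F (fun n => ‖a n‖ * |(n : ℝ)| ^ b) using 1
  · refine Finset.sum_congr rfl fun n hn => Finset.sum_congr rfl fun m hm => ?_
    have h1 := Real.rpow_pos_of_pos (hpos n hn) b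
    have h2 := Real.rpow_pos_of_pos (hpos m hm) b
    rw [weightedCovMatrix, if_neg (by simp [hne n hn, hne m hm]), abs_mul,
      Real.mul_rpow (abs_nonneg _) (abs_nonneg _), Real.rpow_neg (abs_nonneg _),
      Real.rpow_neg (abs_nonneg _)]
    field_simp
  · congr 1
    refine Finset.sum_congr rfl fun n hn => ?_
    rw [sobolevWeight, if_neg (hne n hn), mul_pow, ← Real.rpow_mul_natCast (abs_nonneg _)]
    push_cast
    rw [mul_comm b 2]
    ring

/-! ### Second-order estimates from the covariance -/

section SecondOrder

variable {α : Type*} [MeasurableSpace α] {Q : Measure α}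

lemma eLpNorm_two_eq_ofReal_sqrt {g : α → ℂ} (hg : MemLp g 2 Q) :
    eLpNorm g 2 Q = ENNReal.ofReal (Real.sqrt (∫ x, ‖g x‖ ^ 2 ∂Q)) := by
  rw [hg.eLpNorm_eq_integral_rpow_norm (by norm_num) (by norm_num), Real.sqrt_eq_rpow]
  norm_num

lemma integral_sum_mul_conj_sum {η : ℤ → α → ℂ} (hη : ∀ n, MemLp (η n) 2 Q)
    (F : Finset ℤ) (a d : ℤ → ℂ) :
    ∫ x, (∑ n ∈ F, a n * η n x) * conj (∑ m ∈ F, d m * η m x) ∂Q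
      = ∑ n ∈ F, ∑ m ∈ F, a n * conj (d m) * ∫ x, η n x * conj (η m x) ∂Q := by
  have hint : ∀ n m, Integrable (fun x => η n x * conj (η m x)) Q := fun n m =>
    (hη n).integrable_mul (hη m).star
  have : ∀ x, (∑ n ∈ F, a n * η n x) * conj (∑ m ∈ F, d m * η m x)
      = ∑ n ∈ F, ∑ m ∈ F, a n * conj (d m) * (η n x * conj (η m x)) := by
    intro x
    rw [map_sum, Finset.sum_mul_sum]
    refine Finset.sum_congr rfl fun n _ => Finset.sum_congr rfl fun m _ => ?_
    rw [map_mul]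
    ring
  simp_rw [this]
  rw [integral_finsetSum _ fun n _ => integrable_finsetSum _ fun m _ => (hint n m).const_mul _]
  refine Finset.sum_congr rfl fun n _ => ?_
  rw [integral_finsetSum _ fun m _ => (hint n m).const_mul _]
  exact Finset.sum_congr rfl fun m _ => integral_const_mul _ _

/-- The sequence `η` has the covariance function `γ` in `L²(Q)`. -/
structure HasCovariance (Q : Measure α) (η : ℤ → α → ℂ) (γ : ℤ → ℂ) : Prop where
  memLp : ∀ n, MemLp (η n) 2 Q
  cov : ∀ n m, ∫ x, η n x * conj (η m x) ∂Q = γ (n - m)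

lemma HasCovariance.memLp_sum {η : ℤ → α → ℂ} {γ : ℤ → ℂ} (h : HasCovariance Q η γ)
    (F : Finset ℤ) (a : ℤ → ℂ) : MemLp (fun x => ∑ n ∈ F, a n * η n x) 2 Q :=
  memLp_finsetSum F fun n _ => (h.memLp n).const_mul (a n)

/-- Discarding the phases by the triangle inequality costs nothing later, since the matrix
hypothesis concerns `|γ|` only. -/
lemma HasCovariance.integral_norm_sq_sum_le {η : ℤ → α → ℂ} {γ : ℤ → ℂ}
    (h : HasCovariance Q η γ) (F : Finset ℤ) (a : ℤ → ℂ) :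
    ∫ x, ‖∑ n ∈ F, a n * η n x‖ ^ 2 ∂Q
      ≤ ∑ n ∈ F, ∑ m ∈ F, ‖a n‖ * ‖a m‖ * ‖γ (n - m)‖ := by
  have h1 : ((∫ x, ‖∑ n ∈ F, a n * η n x‖ ^ 2 ∂Q : ℝ) : ℂ)
      = ∑ n ∈ F, ∑ m ∈ F, a n * conj (a m) * γ (n - m) := by
    rw [← integral_complex_ofReal]
    simp_rw [← h.cov]
    rw [← integral_sum_mul_conj_sum h.memLp]
    refine integral_congr_ae (ae_of_all _ fun x => ?_)
    beta_reduce
    rw [RCLike.mul_conj]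
    simp
  have h2 : ∫ x, ‖∑ n ∈ F, a n * η n x‖ ^ 2 ∂Q
      ≤ ‖((∫ x, ‖∑ n ∈ F, a n * η n x‖ ^ 2 ∂Q : ℝ) : ℂ)‖ := by
    rw [Complex.norm_real]
    exact le_abs_self _
  refine h2.trans ?_
  rw [h1]
  refine (norm_sum_le _ _).trans (Finset.sum_le_sum fun n _ => (norm_sum_le _ _).trans
    (Finset.sum_le_sum fun m _ => ?_))
  simp

/-- The matrix carries no information on the frequency `0`, so that term is split off and controlled
by the unit variance; it accounts for the `+ 1` in the constant. The constant is chosen before the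
measure and the sequence. -/
lemma IsBoundedMatrix.exists_eLpNorm_sum_le {γ : ℤ → ℂ} {b : ℝ}
    (h : IsBoundedMatrix (weightedCovMatrix γ b)) :
    ∃ K : ℝ, 0 < K ∧ ∀ {α : Type*} [MeasurableSpace α] {Q : Measure α} {η : ℤ → α → ℂ},
      HasCovariance Q η γ → γ 0 = 1 → ∀ (F : Finset ℤ) (a : ℤ → ℂ),
      eLpNorm (fun x => ∑ n ∈ F, a n * η n x) 2 Q
        ≤ ENNReal.ofReal (K * Real.sqrt (∑ n ∈ F, sobolevWeight b n * ‖a n‖ ^ 2)) := by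
  obtain ⟨C, hC, hF⟩ := h.exists_sum_norm_le
  refine ⟨Real.sqrt C + 1, by positivity, fun {α} _ Q η hη hγ F a => ?_⟩
  set R : ℝ := ∑ n ∈ F, sobolevWeight b n * ‖a n‖ ^ 2 with hR
  have hterm : ∀ n, 0 ≤ sobolevWeight b n * ‖a n‖ ^ 2 := fun n =>
    mul_nonneg (sobolevWeight_pos b n).le (by positivity)
  have hmain : eLpNorm (fun x => ∑ n ∈ F.erase 0, a n * η n x) 2 Q
      ≤ ENNReal.ofReal (Real.sqrt C * Real.sqrt R) := by
    rw [eLpNorm_two_eq_ofReal_sqrt (hη.memLp_sum _ a), ← Real.sqrt_mul hC]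
    refine ENNReal.ofReal_le_ofReal (Real.sqrt_le_sqrt ?_)
    refine (hη.integral_norm_sq_sum_le _ a).trans ((hF _ a (by simp)).trans ?_)
    exact mul_le_mul_of_nonneg_left (Finset.sum_le_sum_of_subset_of_nonneg
      (Finset.erase_subset _ _) fun n _ _ => hterm n) hC
  by_cases h0 : (0 : ℤ) ∈ F
  · have hzero : eLpNorm (fun x => a 0 * η 0 x) 2 Q ≤ ENNReal.ofReal (Real.sqrt R) := by
      have h3 := hη.integral_norm_sq_sum_le {0} a
      have h4 := hη.memLp_sum {0} a
      simp only [Finset.sum_singleton, sub_zero, hγ, norm_one, mul_one] at h3 h4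
      rw [eLpNorm_two_eq_ofReal_sqrt h4]
      refine ENNReal.ofReal_le_ofReal (Real.sqrt_le_sqrt (h3.trans ?_))
      refine le_trans (le_of_eq ?_) (Finset.single_le_sum (fun n _ => hterm n) h0)
      simp [sobolevWeight, sq]
    have hsplit : (fun x => ∑ n ∈ F, a n * η n x)
        = (fun x => ∑ n ∈ F.erase 0, a n * η n x) + fun x => a 0 * η 0 x := by
      ext x
      exact (Finset.sum_erase_add _ _ h0).symm
    rw [hsplit, add_mul, one_mul, ENNReal.ofReal_add (by positivity) (by positivity)]
    exact (eLpNorm_add_le (hη.memLp_sum _ a).aestronglyMeasurable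
      ((hη.memLp 0).const_mul (a 0)).aestronglyMeasurable (by norm_num)).trans
      (add_le_add hmain hzero)
  · rw [Finset.erase_eq_of_notMem h0] at hmain
    refine hmain.trans (ENNReal.ofReal_le_ofReal ?_)
    nlinarith [Real.sqrt_nonneg R]

end SecondOrder

/-! ### Condensation of the entropy condition -/

section Condensation

/-- Condensing along `n = 2^k` gives `∑ s (2^k) / √(k log 2)`; condensing again along `k = 2^j`
gives `2^j / √(2^j) = √(2^j)` in front of `s (2^{2^j})`. -/
lemma summable_sqrt_two_pow_mul_of_summable_div {s : ℕ → ℝ} (hs : ∀ n, 0 ≤ s n)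
    (hanti : Antitone s) (h : Summable fun n : ℕ => s n / (n * Real.sqrt (Real.log n))) :
    Summable fun j : ℕ => Real.sqrt (2 ^ j) * s (2 ^ 2 ^ j) := by
  have hl2 : 0 < Real.log 2 := Real.log_pos one_lt_two
  rw [← summable_condensed_iff_of_eventually_nonneg] at h
  rotate_left
  · exact Eventually.of_forall fun n => div_nonneg (hs n) (by positivity)
  -- At `n = 1` the logarithm vanishes and the quotient is `0` by convention, so the terms decrease
  -- only from `2` on.
  · filter_upwards [eventually_ge_atTop 2] with k hk
    have hk' : (2 : ℝ) ≤ k := by exact_mod_cast hk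
    have hlog : 0 < Real.log k := Real.log_pos (by linarith)
    refine div_le_div₀ (hs k) (hanti k.le_succ) (by positivity) ?_
    push_cast
    gcongr <;> linarith
  have h' : Summable fun k : ℕ => s (2 ^ k) / Real.sqrt (k * Real.log 2) := by
    refine h.congr fun k => ?_
    push_cast
    rw [Real.log_pow]
    field_simp
  rw [← summable_condensed_iff_of_eventually_nonneg] at h'
  rotate_left
  · exact Eventually.of_forall fun n => div_nonneg (hs _) (by positivity)
  · filter_upwards [eventually_ge_atTop 1] with k hk
    have hk' : (1 : ℝ) ≤ k := by exact_mod_cast hk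
    refine div_le_div₀ (hs _) (hanti (Nat.pow_le_pow_right two_pos k.le_succ))
      (Real.sqrt_pos.2 (by positivity)) ?_
    push_cast
    gcongr
    linarith
  refine (h'.mul_right (Real.sqrt (Real.log 2))).congr fun j => ?_
  push_cast
  rw [Real.sqrt_mul (by positivity)]
  have h2 : (2 : ℝ) ^ j = Real.sqrt (2 ^ j) * Real.sqrt (2 ^ j) :=
    (Real.mul_self_sqrt (by positivity)).symm
  have h3 : 0 < Real.sqrt ((2 : ℝ) ^ j) := Real.sqrt_pos.2 (by positivity)
  have h4 : 0 < Real.sqrt (Real.log 2) := Real.sqrt_pos.2 hl2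
  field_simp
  rw [sq, ← h2, mul_comm]

lemma weightedTail_anti (c : ℤ → ℂ) (b : ℝ) {n m : ℤ} (h : |n| ≤ |m|) :
    weightedTail c b m ≤ weightedTail c b n := by
  let i : {k : ℤ // |m| ≤ |k|} → {k : ℤ // |n| ≤ |k|} := fun k => ⟨k, h.trans k.2⟩
  have hi : Function.Injective i := fun x y hxy => Subtype.ext (congrArg (fun z => z.1) hxy)
  exact ENNReal.tsum_comp_le_tsum_of_injective hi
    (fun k => ENNReal.ofReal (‖c k‖ ^ 2 * |((k : ℤ) : ℝ)| ^ (2 * b)))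

lemma sum_sobolevWeight_le_weightedTail {c : ℤ → ℂ} {b : ℝ} {n : ℤ} (hn : n ≠ 0)
    (hfin : weightedTail c b n ≠ ∞) {F : Finset ℤ} (hF : ∀ k ∈ F, |n| ≤ |k|) :
    ∑ k ∈ F, sobolevWeight b k * ‖c k‖ ^ 2 ≤ (weightedTail c b n).toReal := by
  have hterm : ∀ k : ℤ, 0 ≤ sobolevWeight b k * ‖c k‖ ^ 2 := fun k =>
    mul_nonneg (sobolevWeight_pos b k).le (by positivity)
  rw [← ENNReal.ofReal_le_iff_le_toReal hfin, ENNReal.ofReal_sum_of_nonneg fun k _ => hterm k]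
  have h1 : ∀ k ∈ F, ENNReal.ofReal (sobolevWeight b k * ‖c k‖ ^ 2)
      = ENNReal.ofReal (‖c k‖ ^ 2 * |((k : ℤ) : ℝ)| ^ (2 * b)) := by
    intro k hk
    have : k ≠ 0 := by
      rintro rfl
      exact hn (by simpa using hF 0 hk)
    rw [sobolevWeight, if_neg this, mul_comm]
  rw [Finset.sum_congr rfl h1, ← Finset.sum_subtype_of_mem _ hF]
  exact ENNReal.sum_le_tsum _

variable {c : ℤ → ℂ} {b : ℝ}

lemma weightedTail_ne_top (h : entropySum c b < ∞) {n : ℤ} (hn : 2 ≤ |n|) :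
    weightedTail c b n ≠ ∞ := by
  intro htop
  have h1 := ENNReal.le_tsum (f := fun n : {n : ℤ // 2 ≤ |n|} => (weightedTail c b n) ^ (1 / 2 : ℝ) /
    ENNReal.ofReal (|((n : ℤ) : ℝ)| * Real.sqrt (Real.log |((n : ℤ) : ℝ)|))) ⟨n, hn⟩
  refine absurd (h1.trans_lt h) ?_
  simp only [htop]
  rw [ENNReal.top_rpow_of_pos (by norm_num), ENNReal.top_div_of_ne_top ENNReal.ofReal_ne_top]
  simp

lemma summable_sobolevWeight (h : entropySum c b < ∞) :
    Summable fun n => sobolevWeight b n * ‖c n‖ ^ 2 := by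
  have hterm : ∀ k : ℤ, 0 ≤ sobolevWeight b k * ‖c k‖ ^ 2 := fun k =>
    mul_nonneg (sobolevWeight_pos b k).le (by positivity)
  refine summable_of_sum_le (c := (weightedTail c b 2).toReal
    + ∑ k ∈ Finset.Icc (-1) 1, sobolevWeight b k * ‖c k‖ ^ 2) hterm fun F => ?_
  rw [← Finset.sum_filter_add_sum_filter_not F (fun k => 2 ≤ |k|)]
  refine add_le_add (sum_sobolevWeight_le_weightedTail two_ne_zero
    (weightedTail_ne_top h (by simp)) fun k hk => by simpa using (Finset.mem_filter.1 hk).2) ?_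
  refine Finset.sum_le_sum_of_subset_of_nonneg (fun k hk => ?_) fun k _ _ => hterm k
  have := (Finset.mem_filter.1 hk).2
  rw [Finset.mem_Icc]
  exact abs_le.1 (by omega)

lemma exists_summable_block_bound (h : entropySum c b < ∞) :
    ∃ s : ℕ → ℝ, (∀ j, 0 ≤ s j) ∧ (Summable fun j : ℕ => Real.sqrt (2 ^ j) * s j) ∧
      ∀ (j : ℕ) (F : Finset ℤ), (∀ n ∈ F, 2 ^ 2 ^ j ≤ |n|) →
        Real.sqrt (∑ n ∈ F, sobolevWeight b n * ‖c n‖ ^ 2) ≤ s j := by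
  -- Tails are known to be finite only from `2` on; the truncation `max n 2` keeps `s` finite and
  -- antitone, and is invisible at `2^{2^j} ≥ 2`.
  set s : ℕ → ℝ := fun n => Real.sqrt (weightedTail c b (max n 2 : ℕ)).toReal with hs
  have hfin : ∀ n : ℕ, weightedTail c b (max n 2 : ℕ) ≠ ∞ := fun n =>
    weightedTail_ne_top h (by rw [Nat.abs_cast]; exact_mod_cast le_max_right n 2)
  have hanti : Antitone s := fun m n hmn => Real.sqrt_le_sqrt
    (ENNReal.toReal_mono (hfin m) (weightedTail_anti c b (by
      rw [Nat.abs_cast, Nat.abs_cast]; exact_mod_cast max_le_max_right 2 hmn)))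
  refine ⟨fun j => s (2 ^ 2 ^ j), fun j => Real.sqrt_nonneg _,
    summable_sqrt_two_pow_mul_of_summable_div (fun n => Real.sqrt_nonneg _) hanti ?_, ?_⟩
  · rw [← summable_nat_add_iff 2]
    let i : ℕ → {n : ℤ // 2 ≤ |n|} := fun k => ⟨(k + 2 : ℕ), by
      rw [Nat.abs_cast]; push_cast; omega⟩
    have hi : Function.Injective i := fun x y hxy => by
      have : ((x + 2 : ℕ) : ℤ) = (y + 2 : ℕ) := congrArg (fun z => z.1) hxy
      omega
    have h1 := ENNReal.summable_toReal
      ((ENNReal.tsum_comp_le_tsum_of_injective hi _).trans_lt h).ne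
    refine h1.congr fun k => ?_
    rw [ENNReal.toReal_div, ← ENNReal.toReal_rpow, ← Real.sqrt_eq_rpow,
      ENNReal.toReal_ofReal (by positivity)]
    simp only [i, hs]
    rw [max_eq_left (by omega)]
    congr 2
    · push_cast
      exact abs_of_nonneg (by positivity)
    · push_cast
      rw [abs_of_nonneg (by positivity)]
  · intro j F hF
    refine Real.sqrt_le_sqrt (sum_sobolevWeight_le_weightedTail ?_ (hfin _) fun k hk => ?_)
    · have := le_max_right (2 ^ 2 ^ j) 2
      omega
    · have h2 : 2 ≤ 2 ^ 2 ^ j := Nat.le_self_pow (by positivity) 2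
      rw [max_eq_left h2, Nat.abs_cast]
      exact_mod_cast hF k hk

end Condensation

/-! ### Sup norms of trigonometric polynomials on a grid -/

section TrigPolynomial

lemma norm_fourier_coe_sub_le (n : ℤ) (x y : ℝ) :
    ‖fourier n (x : UnitAddCircle) - fourier n (y : UnitAddCircle)‖
      ≤ 2 * Real.pi * |(n : ℝ)| * |x - y| := by
  have h : (fourier n (x : UnitAddCircle) : ℂ) - fourier n (y : UnitAddCircle)
      = fourier n (y : UnitAddCircle)
        * (Complex.exp (Complex.I * ((2 * Real.pi * n * (x - y) : ℝ) : ℂ)) - 1) := by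
    rw [mul_sub, mul_one, fourier_coe_apply, fourier_coe_apply, ← Complex.exp_add]
    congr 2
    push_cast
    ring
  rw [h, norm_mul, fourier_apply, Circle.norm_coe, one_mul]
  refine Real.norm_exp_I_mul_ofReal_sub_one_le.trans (le_of_eq ?_)
  rw [Real.norm_eq_abs, abs_mul, abs_mul, abs_mul, abs_of_pos Real.pi_pos]
  norm_num

/-- The trigonometric polynomial with coefficients `a` and spectrum in `F`. -/
noncomputable def trigPoly (F : Finset ℤ) (a : ℤ → ℂ) : C(UnitAddCircle, ℂ) := ∑ n ∈ F, a n • fourier n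

lemma trigPoly_apply (F : Finset ℤ) (a : ℤ → ℂ) (t : UnitAddCircle) :
    trigPoly F a t = ∑ n ∈ F, a n * fourier n t := by
  simp [trigPoly, ContinuousMap.sum_apply]

/-- A coefficient is the inner product with a unit vector of `L²`, and the `L²` norm for a
probability measure is at most the sup norm. -/
lemma norm_coeff_le_norm_trigPoly {F : Finset ℤ} (a : ℤ → ℂ) {n : ℤ} (hn : n ∈ F) :
    ‖a n‖ ≤ ‖trigPoly F a‖ := by
  have h1 : ContinuousMap.toLp (E := ℂ) 2 haarAddCircle ℂ (trigPoly F a)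
      = ∑ m ∈ F, a m • fourierLp (T := 1) 2 m := by
    rw [trigPoly, map_sum]
    simp_rw [map_smul]
  have h2 := (orthonormal_fourier (T := (1 : ℝ))).inner_right_sum a hn
  rw [← h1] at h2
  rw [← h2]
  refine (norm_inner_le_norm _ _).trans ?_
  rw [orthonormal_fourier.1 n, one_mul]
  refine (ContinuousLinearMap.le_opNorm _ _).trans ?_
  refine mul_le_of_le_one_left (norm_nonneg _) ?_
  refine (ContinuousMap.toLp_norm_le _).trans (le_of_eq ?_)
  have h3 : measureUnivNNReal (haarAddCircle (T := (1 : ℝ))) = 1 := by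
    ext
    simp [measureUnivNNReal]
  simp [h3]

/-- The points of a uniform grid on the circle. -/
noncomputable def gridPoint (M k : ℕ) : UnitAddCircle := ((k / M : ℝ) : UnitAddCircle)

/-- The sup norm of a trigonometric polynomial of degree `N` is controlled by its values on a
grid with `64 N ^ 2` points. -/
lemma norm_trigPoly_le {F : Finset ℤ} {N : ℕ} (hN : 1 ≤ N) (hF : ∀ n ∈ F, |n| ≤ N) (a : ℤ → ℂ)
    {R : ℝ} (hR : ∀ k < 64 * N ^ 2, ‖trigPoly F a (gridPoint (64 * N ^ 2) k)‖ ≤ R) :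
    ‖trigPoly F a‖ ≤ 2 * R := by
  set q := ‖trigPoly F a‖ with hq
  set M : ℕ := 64 * N ^ 2 with hM
  have hMpos : 0 < M := by positivity
  have hMr : (0 : ℝ) < M := by exact_mod_cast hMpos
  have hN' : (1 : ℝ) ≤ N := by exact_mod_cast hN
  have hcard : (F.card : ℝ) ≤ 3 * N := by
    have h1 : F ⊆ Finset.Icc (-(N : ℤ)) N := fun n hn => Finset.mem_Icc.2 (abs_le.1 (hF n hn))
    have h2 := Finset.card_le_card h1
    rw [Int.card_Icc] at h2
    have h3 : F.card ≤ 3 * N := by omega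
    exact_mod_cast h3
  -- The sup norm `q` also bounds every coefficient. Moving to a grid point at distance at most `1 /
  -- M` changes the at most `3 N` terms by at most `q * 8 N / M` each, in all `24 N² q / (64 N²) ≤ q
  -- / 2`, which is absorbed on the left.
  suffices hkey : q ≤ R + q / 2 by linarith
  have hR0 : 0 ≤ R := (norm_nonneg _).trans (hR 0 hMpos)
  have hq0 : 0 ≤ q := norm_nonneg _
  refine (ContinuousMap.norm_le _ (by positivity)).2 fun t => ?_
  obtain ⟨x, hx, rfl⟩ : ∃ x : ℝ, x ∈ Set.Ico (0 : ℝ) 1 ∧ (x : UnitAddCircle) = t :=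
    ⟨(equivIco 1 0 t : ℝ), by simpa using (equivIco (1 : ℝ) 0 t).2, (equivIco 1 0).symm_apply_apply t⟩
  set k := ⌊x * M⌋₊ with hk
  have hxM : 0 ≤ x * M := mul_nonneg hx.1 hMr.le
  have hkM : k < M := by
    rw [hk, Nat.floor_lt hxM]
    nlinarith [hx.2]
  have hdist : |x - k / M| ≤ 1 / M := by
    have h1 := Nat.floor_le hxM
    have h2 := Nat.lt_floor_add_one (x * M)
    rw [← hk] at h1 h2
    have h3 : x - k / M = (x * M - k) / M := by field_simp
    rw [h3, abs_div, abs_of_pos hMr]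
    gcongr
    rw [abs_le]
    constructor <;> linarith
  have hdiff : ‖trigPoly F a (x : UnitAddCircle) - trigPoly F a (gridPoint M k)‖ ≤ q / 2 := by
    rw [trigPoly_apply, trigPoly_apply, ← Finset.sum_sub_distrib]
    calc _ ≤ ∑ n ∈ F, q * (2 * Real.pi * N * (1 / M)) := by
          refine (norm_sum_le _ _).trans (Finset.sum_le_sum fun n hn => ?_)
          rw [← mul_sub, norm_mul]
          refine mul_le_mul (norm_coeff_le_norm_trigPoly a hn)
            ((norm_fourier_coe_sub_le n _ _).trans ?_) (norm_nonneg _) hq0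
          have : |(n : ℝ)| ≤ N := by exact_mod_cast hF n hn
          gcongr
      _ = F.card * (q * (2 * Real.pi * N * (1 / M))) := by rw [Finset.sum_const, nsmul_eq_mul]
      _ ≤ 3 * N * (q * (2 * 4 * N * (1 / M))) := by
          gcongr
          exact Real.pi_le_four
      _ ≤ q / 2 := by
          rw [hM]
          push_cast
          field_simp
          nlinarith
  calc _ ≤ ‖trigPoly F a (gridPoint M k)‖
        + ‖trigPoly F a (x : UnitAddCircle) - trigPoly F a (gridPoint M k)‖ := by
        rw [add_comm]; exact norm_le_norm_sub_add _ _
    _ ≤ R + q / 2 := add_le_add (hR k hkM) hdiff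

end TrigPolynomial

/-! ### Gaussian tail bounds -/

section GaussianTail

variable {Ω : Type*} [MeasurableSpace Ω] {P : Measure Ω} [IsProbabilityMeasure P]

lemma measure_le_norm_real_gaussian {X : Ω → ℝ} (hX : HasGaussianLaw X P) (h0 : P[X] = 0)
    {σ : ℝ} (hvar : ∫ ω, X ω ^ 2 ∂P ≤ σ ^ 2) {r : ℝ} (hr : 0 ≤ r) :
    P.real {ω | r ≤ |X ω|} ≤ 2 * Real.exp (-r ^ 2 / (2 * σ ^ 2)) := by
  have hsub : ∀ {Y : Ω → ℝ}, HasGaussianLaw Y P → P[Y] = 0 → ∫ ω, Y ω ^ 2 ∂P ≤ σ ^ 2 →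
      HasSubgaussianMGF Y (σ ^ 2).toNNReal P := by
    intro Y hY h0 hvar
    have hmap := hY.map_eq_gaussianReal
    have hmgf := mgf_gaussianReal hmap
    refine ⟨fun t => ?_, fun t => ?_⟩
    -- A non-integrable exponential would have `mgf` equal to `0` by convention, against the
    -- explicit positive value.
    · have : (0 : ℝ) < mgf Y P t := by rw [hmgf]; positivity
      by_contra hcon
      exact this.ne' (mgf_undef hcon)
    · rw [hmgf, h0]
      have hv : Var[Y; P] ≤ σ ^ 2 := by
        rw [variance_of_integral_eq_zero hY.aemeasurable h0]
        exact hvar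
      simp only [zero_mul, zero_add]
      gcongr
  have key : ∀ {Y : Ω → ℝ}, HasSubgaussianMGF Y (σ ^ 2).toNNReal P →
      P.real {ω | r ≤ Y ω} ≤ Real.exp (-r ^ 2 / (2 * σ ^ 2)) := by
    intro Y hY
    have := hY.measure_ge_le hr
    rwa [Real.coe_toNNReal _ (sq_nonneg σ)] at this
  have hsubset : {ω | r ≤ |X ω|} ⊆ {ω | r ≤ X ω} ∪ {ω | r ≤ (-X) ω} := fun ω hω => by
    simpa [le_abs] using hω
  have h1 := hsub hX h0 hvar
  calc _ ≤ P.real {ω | r ≤ X ω} + P.real {ω | r ≤ (-X) ω} :=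
        (measureReal_mono hsubset).trans (measureReal_union_le _ _)
    _ ≤ _ := by linarith [key h1, key h1.neg]

/-- If `‖Z‖ ≥ 2 r`, the real or the imaginary part is at least `r` in absolute value, and each has
variance at most `E ‖Z‖²`. Circular symmetry plays no role. -/
lemma measure_le_norm_complex_gaussian {Z : Ω → ℂ} (hZ : HasGaussianLaw Z P)
    (h0 : ∫ ω, Z ω ∂P = 0) {σ : ℝ} (hσ : 0 ≤ σ) (hvar : eLpNorm Z 2 P ≤ ENNReal.ofReal σ)
    {r : ℝ} (hr : 0 ≤ r) :
    P.real {ω | 2 * r ≤ ‖Z ω‖} ≤ 4 * Real.exp (-r ^ 2 / (2 * σ ^ 2)) := by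
  have hmem : MemLp Z 2 P := hZ.memLp_two
  have hZint : Integrable Z P := hZ.integrable
  have hnorm : ∫ ω, ‖Z ω‖ ^ 2 ∂P ≤ σ ^ 2 := by
    rw [eLpNorm_two_eq_ofReal_sqrt hmem, ENNReal.ofReal_le_ofReal_iff hσ] at hvar
    exact Real.sqrt_le_left hσ |>.1 hvar
  have hre : HasGaussianLaw (fun ω => (Z ω).re) P := hZ.map_fun Complex.reCLM
  have him : HasGaussianLaw (fun ω => (Z ω).im) P := hZ.map_fun Complex.imCLM
  have hre0 : ∫ ω, (Z ω).re ∂P = 0 := by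
    have := integral_re hZint (𝕜 := ℂ)
    simpa [h0] using this
  have him0 : ∫ ω, (Z ω).im ∂P = 0 := by
    have := integral_im hZint (𝕜 := ℂ)
    simpa [h0] using this
  have hsq : Integrable (fun ω => ‖Z ω‖ ^ 2) P := hmem.integrable_norm_pow (by norm_num)
  have hre2 : ∫ ω, (Z ω).re ^ 2 ∂P ≤ σ ^ 2 := by
    refine (integral_mono_of_nonneg (ae_of_all _ fun ω => sq_nonneg _) hsq
      (ae_of_all _ fun ω => ?_)).trans hnorm
    exact sq_le_sq' (neg_le_of_abs_le (Complex.abs_re_le_norm _)) (Complex.re_le_norm _)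
  have him2 : ∫ ω, (Z ω).im ^ 2 ∂P ≤ σ ^ 2 := by
    refine (integral_mono_of_nonneg (ae_of_all _ fun ω => sq_nonneg _) hsq
      (ae_of_all _ fun ω => ?_)).trans hnorm
    exact sq_le_sq' (neg_le_of_abs_le (Complex.abs_im_le_norm _)) (Complex.im_le_norm _)
  have hsubset : {ω | 2 * r ≤ ‖Z ω‖} ⊆ {ω | r ≤ |(Z ω).re|} ∪ {ω | r ≤ |(Z ω).im|} := by
    intro ω hω
    by_contra hcon
    simp only [Set.mem_union, Set.mem_ofPred_eq, not_or, not_le] at hcon hω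
    linarith [Complex.norm_le_abs_re_add_abs_im (Z ω)]
  calc _ ≤ P.real {ω | r ≤ |(Z ω).re|} + P.real {ω | r ≤ |(Z ω).im|} :=
        (measureReal_mono hsubset).trans (measureReal_union_le _ _)
    _ ≤ _ := by
      linarith [measure_le_norm_real_gaussian hre hre0 hre2 hr,
        measure_le_norm_real_gaussian him him0 him2 hr]

end GaussianTail

/-! ### Almost sure boundedness of the random Fourier series -/

section RandomSeries

variable {Ω : Type*} [MeasurableSpace Ω] {P : Measure Ω} {ξ : ℤ → Ω → ℂ}

lemma ProbabilityTheory.IsGaussianProcess.hasGaussianLaw_sum_mul (hG : IsGaussianProcess ξ P)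
    (F : Finset ℤ) (a : ℤ → ℂ) : HasGaussianLaw (fun ω => ∑ n ∈ F, a n * ξ n ω) P :=
  (hG.comp_left fun n => ContinuousLinearMap.mul ℝ ℂ (a n)).hasGaussianLaw_fun_sum

lemma integral_sum_mul_eq_zero (hG : IsGaussianProcess ξ P) (h0 : ∀ n, ∫ ω, ξ n ω ∂P = 0)
    (F : Finset ℤ) (a : ℤ → ℂ) : ∫ ω, ∑ n ∈ F, a n * ξ n ω ∂P = 0 := by
  rw [integral_finsetSum _ fun n _ => (hG.hasGaussianLaw_eval n).integrable.const_mul (a n)]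
  refine Finset.sum_eq_zero fun n _ => ?_
  rw [integral_const_mul, h0, mul_zero]

/-- Union bound over the `64 N²` grid points, each with tail constant `4`. One factor `2` in `4 * r`
comes from the grid, the other from the real and imaginary parts. -/
lemma measure_lt_norm_trigPoly_le [IsProbabilityMeasure P] (hG : IsGaussianProcess ξ P) (h0 : ∀ n, ∫ ω, ξ n ω ∂P = 0)
    {F : Finset ℤ} {N : ℕ} (hN : 1 ≤ N) (hF : ∀ n ∈ F, |n| ≤ N) (c : ℤ → ℂ) {σ : ℝ} (hσ : 0 ≤ σ)
    (hvar : ∀ t : UnitAddCircle,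
      eLpNorm (fun ω => ∑ n ∈ F, c n * fourier n t * ξ n ω) 2 P ≤ ENNReal.ofReal σ)
    {r : ℝ} (hr : 0 ≤ r) :
    P.real {ω | 4 * r < ‖trigPoly F fun n => c n * ξ n ω‖}
      ≤ 256 * N ^ 2 * Real.exp (-r ^ 2 / (2 * σ ^ 2)) := by
  set M := 64 * N ^ 2 with hM
  have hval : ∀ t ω, trigPoly F (fun n => c n * ξ n ω) t
      = ∑ n ∈ F, c n * fourier n t * ξ n ω := by
    intro t ω
    rw [trigPoly_apply]
    exact Finset.sum_congr rfl fun n _ => by ring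
  have hsubset : {ω | 4 * r < ‖trigPoly F fun n => c n * ξ n ω‖}
      ⊆ ⋃ k ∈ Finset.range M,
        {ω | 2 * r ≤ ‖∑ n ∈ F, c n * fourier n (gridPoint M k) * ξ n ω‖} := by
    intro ω hω
    by_contra hcon
    simp only [Set.mem_iUnion, Set.mem_ofPred_eq, not_exists, not_le, Finset.mem_range] at hcon
    have := norm_trigPoly_le hN hF (fun n => c n * ξ n ω) (R := 2 * r) fun k hk => by
      rw [hval]
      exact (hcon k hk).le
    have h2 : 4 * r < ‖trigPoly F fun n => c n * ξ n ω‖ := hω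
    linarith
  calc _ ≤ ∑ k ∈ Finset.range M,
        P.real {ω | 2 * r ≤ ‖∑ n ∈ F, c n * fourier n (gridPoint M k) * ξ n ω‖} :=
        (measureReal_mono hsubset (measure_ne_top _ _)).trans (measureReal_biUnion_finset_le _ _)
    _ ≤ ∑ k ∈ Finset.range M, 4 * Real.exp (-r ^ 2 / (2 * σ ^ 2)) :=
        Finset.sum_le_sum fun k _ => measure_le_norm_complex_gaussian
          (hG.hasGaussianLaw_sum_mul F _) (integral_sum_mul_eq_zero hG h0 F _) hσ (hvar _) hr
    _ = _ := by
        rw [Finset.sum_const, Finset.card_range, nsmul_eq_mul, hM]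
        push_cast
        ring

/-- The frequencies `n` with `|n| < 2 ^ 2 ^ j`. -/
noncomputable def freqBox (j : ℕ) : Finset ℤ := Finset.Ioo (-2 ^ 2 ^ j) (2 ^ 2 ^ j)

lemma mem_freqBox {j : ℕ} {n : ℤ} : n ∈ freqBox j ↔ |n| < 2 ^ 2 ^ j := by
  rw [freqBox, Finset.mem_Ioo, abs_lt]

lemma freqBox_mono : Monotone freqBox := fun i j h n hn => by
  rw [mem_freqBox] at hn ⊢
  exact hn.trans_le (pow_le_pow_right₀ one_le_two (Nat.pow_le_pow_right two_pos h))

lemma tendsto_freqBox : Tendsto freqBox atTop atTop := by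
  refine tendsto_atTop_finset_of_monotone freqBox_mono fun n => ⟨n.natAbs, ?_⟩
  rw [mem_freqBox, Int.abs_eq_natAbs]
  have h1 : n.natAbs < 2 ^ 2 ^ n.natAbs :=
    Nat.lt_two_pow_self.trans (Nat.pow_lt_pow_right one_lt_two Nat.lt_two_pow_self)
  exact_mod_cast h1

/-- The estimate of `L²(Q)` norms of finite sums by the weighted `ℓ²` norm of the coefficients. -/
def HasWeightedBound {α : Type*} [MeasurableSpace α] (Q : Measure α) (η : ℤ → α → ℂ)
    (w : ℤ → ℝ) (K : ℝ) : Prop :=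
  ∀ (F : Finset ℤ) (a : ℤ → ℂ), eLpNorm (fun x => ∑ n ∈ F, a n * η n x) 2 Q
    ≤ ENNReal.ofReal (K * Real.sqrt (∑ n ∈ F, w n * ‖a n‖ ^ 2))

lemma HasWeightedBound.eLpNorm_fourier_le {α : Type*} [MeasurableSpace α] {Q : Measure α}
    {η : ℤ → α → ℂ} {w : ℤ → ℝ} {K : ℝ} (h : HasWeightedBound Q η w K) (F : Finset ℤ)
    (c : ℤ → ℂ) (t : UnitAddCircle) :
    eLpNorm (fun x => ∑ n ∈ F, c n * fourier n t * η n x) 2 Q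
      ≤ ENNReal.ofReal (K * Real.sqrt (∑ n ∈ F, w n * ‖c n‖ ^ 2)) := by
  refine (h F fun n => c n * fourier n t).trans (le_of_eq ?_)
  simp_rw [norm_mul, fourier_apply, Circle.norm_coe, mul_one]

lemma ae_summable_norm_trigPoly [IsProbabilityMeasure P] (hG : IsGaussianProcess ξ P) (h0 : ∀ n, ∫ ω, ξ n ω ∂P = 0)
    {w : ℤ → ℝ} {K : ℝ} (hK : 0 < K) (hB : HasWeightedBound P ξ w K) (c : ℤ → ℂ)
    {s : ℕ → ℝ} (hs0 : ∀ j, 0 ≤ s j) (hs : Summable fun j : ℕ => Real.sqrt (2 ^ j) * s j)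
    (hblock : ∀ (j : ℕ) (F : Finset ℤ), (∀ n ∈ F, 2 ^ 2 ^ j ≤ |n|) →
        Real.sqrt (∑ n ∈ F, w n * ‖c n‖ ^ 2) ≤ s j) :
    ∀ᵐ ω ∂P, Summable fun j =>
      ‖trigPoly (freqBox (j + 1) \ freqBox j) fun n => c n * ξ n ω‖ := by
  -- The summand `(1 / 4) ^ j` keeps `σ j` positive, so that it can be cancelled in the exponent,
  -- and stays summable against `√(2^j)`.
  set σ : ℕ → ℝ := fun j => K * (s j + (1 / 4) ^ j) with hσ
  have hσpos : ∀ j, 0 < σ j := fun j => mul_pos hK (add_pos_of_nonneg_of_pos (hs0 j) (by positivity))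
  -- The factor `4` makes the Gaussian exponent exactly `-8 * 2^j`, which beats `N² ≤ exp (4 * 2^j)`
  -- for `N = 2^{2^{j+1}}`.
  set r : ℕ → ℝ := fun j => 4 * (Real.sqrt (2 ^ j) * σ j) with hr
  have hr0 : ∀ j, 0 ≤ r j := fun j => by have := hσpos j; positivity
  have hrsum : Summable r := by
    have h1 : Summable fun j : ℕ => Real.sqrt (2 ^ j) * (1 / 4) ^ j := by
      refine Summable.of_nonneg_of_le (fun j => by positivity) (fun j => ?_)
        (summable_geometric_of_lt_one (r := (1 / 2 : ℝ)) (by norm_num) (by norm_num))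
      have h2 : Real.sqrt ((2 : ℝ) ^ j) ≤ 2 ^ j := by
        rw [Real.sqrt_le_left (by positivity)]
        exact le_self_pow₀ (one_le_pow₀ one_le_two) two_ne_zero
      calc _ ≤ (2 : ℝ) ^ j * (1 / 4) ^ j := by gcongr
        _ = (1 / 2) ^ j := by rw [← mul_pow]; norm_num
    exact (((hs.add h1).mul_left K).mul_left 4).congr fun j => by simp only [hr, hσ]; ring
  have hvar : ∀ (j : ℕ) (t : UnitAddCircle),
      eLpNorm (fun ω => ∑ n ∈ freqBox (j + 1) \ freqBox j, c n * fourier n t * ξ n ω) 2 P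
        ≤ ENNReal.ofReal (σ j) := by
    intro j t
    refine (hB.eLpNorm_fourier_le _ c t).trans (ENNReal.ofReal_le_ofReal ?_)
    refine mul_le_mul_of_nonneg_left ?_ hK.le
    refine (hblock j _ fun n hn => ?_).trans (le_add_of_nonneg_right (by positivity))
    have := (Finset.mem_sdiff.1 hn).2
    rwa [mem_freqBox, not_lt] at this
  have hprob : ∀ j, P.real {ω | 4 * r j
      < ‖trigPoly (freqBox (j + 1) \ freqBox j) fun n => c n * ξ n ω‖}
        ≤ 256 * Real.exp (-j) := by
    intro j
    have h1 := measure_lt_norm_trigPoly_le hG h0 (F := freqBox (j + 1) \ freqBox j)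
      (N := 2 ^ 2 ^ (j + 1)) Nat.one_le_two_pow (fun n hn => by
        have := (Finset.mem_sdiff.1 hn).1
        rw [mem_freqBox] at this
        exact_mod_cast this.le) c (hσpos j).le (hvar j) (hr0 j)
    refine h1.trans ?_
    have h2 : -(r j) ^ 2 / (2 * (σ j) ^ 2) = -(8 * 2 ^ j) := by
      have := hσpos j
      rw [hr]
      simp only
      rw [mul_pow, mul_pow, Real.sq_sqrt (by positivity)]
      field_simp
      norm_num
    rw [h2, mul_assoc]
    refine mul_le_mul_of_nonneg_left ?_ (by norm_num)
    have h3 : (((2 ^ 2 ^ (j + 1) : ℕ) : ℝ)) ≤ Real.exp (2 * 2 ^ j) := by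
      push_cast
      calc (2 : ℝ) ^ 2 ^ (j + 1) ≤ Real.exp 1 ^ 2 ^ (j + 1) := by
            gcongr
            linarith [Real.add_one_le_exp 1]
        _ = _ := by
            rw [← Real.exp_nat_mul]
            congr 1
            push_cast
            ring
    have h4 : (j : ℝ) ≤ 2 ^ j := by exact_mod_cast (Nat.lt_two_pow_self (n := j)).le
    calc _ ≤ Real.exp (2 * 2 ^ j) ^ 2 * Real.exp (-(8 * 2 ^ j)) := by gcongr
      _ = Real.exp (-(4 * 2 ^ j)) := by
          rw [← Real.exp_nat_mul, ← Real.exp_add]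
          congr 1
          push_cast
          ring
      _ ≤ _ := by
          gcongr
          linarith [pow_pos (zero_lt_two (α := ℝ)) j]
  have htsum : ∑' j, P {ω | 4 * r j
      < ‖trigPoly (freqBox (j + 1) \ freqBox j) fun n => c n * ξ n ω‖} ≠ ∞ := by
    have h1 : Summable fun j : ℕ => 256 * Real.exp (-j) := Real.summable_exp_neg_nat.mul_left _
    refine ne_top_of_le_ne_top h1.tsum_ofReal_ne_top (ENNReal.tsum_le_tsum fun j => ?_)
    rw [← ofReal_measureReal]
    exact ENNReal.ofReal_le_ofReal (hprob j)
  filter_upwards [ae_eventually_notMem htsum] with ω hω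
  refine Summable.of_norm_bounded_eventually_nat (hrsum.mul_left 4) ?_
  filter_upwards [hω] with j hj
  rw [norm_norm]
  exact not_lt.1 hj

/-- By Fatou along the boxes, almost sure convergence identifies the `L²` limit: the distance from
the sum over `F` to `S t` is bounded by the weighted tail outside `F`. As `F` is any finite set, the
convergence is unconditional. -/
lemma isRandomFourierSum_of_ae_tendsto {γ : ℤ → ℂ} (hcov : HasCovariance P ξ γ)
    {w : ℤ → ℝ} {K : ℝ} (hw : ∀ n, 0 ≤ w n) (hK : 0 < K) (hB : HasWeightedBound P ξ w K)
    {c : ℤ → ℂ} (hc : Summable fun n => w n * ‖c n‖ ^ 2) {S : UnitAddCircle → Ω → ℂ}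
    (hS : ∀ t, ∀ᵐ ω ∂P, Tendsto (fun j => ∑ n ∈ freqBox j, c n * ξ n ω * fourier n t) atTop
      (𝓝 (S t ω))) :
    IsRandomFourierSum P c ξ S := by
  intro t
  have hv : ∀ n, 0 ≤ w n * ‖c n‖ ^ 2 := fun n => mul_nonneg (hw n) (by positivity)
  have hcomm : ∀ (F : Finset ℤ) ω, ∑ n ∈ F, c n * ξ n ω * fourier n t
      = ∑ n ∈ F, c n * fourier n t * ξ n ω := fun F ω =>
    Finset.sum_congr rfl fun n _ => by ring
  have hmeas : ∀ F : Finset ℤ,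
      AEStronglyMeasurable (fun ω => ∑ n ∈ F, c n * ξ n ω * fourier n t) P := by
    intro F
    simp_rw [hcomm]
    exact (hcov.memLp_sum F _).aestronglyMeasurable
  have hSm : AEStronglyMeasurable (S t) P :=
    aestronglyMeasurable_of_tendsto_ae atTop (fun j => hmeas (freqBox j)) (hS t)
  have hbound : ∀ F : Finset ℤ,
      eLpNorm (fun ω => (∑ n ∈ F, c n * ξ n ω * fourier n t) - S t ω) 2 P
        ≤ ENNReal.ofReal (K * Real.sqrt (∑' n : {n // n ∉ F}, w n * ‖c n‖ ^ 2)) := by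
    intro F
    refine (Lp.eLpNorm_lim_le_liminf_eLpNorm (f := fun j ω => (∑ n ∈ F, c n * ξ n ω * fourier n t)
      - ∑ n ∈ freqBox j, c n * ξ n ω * fourier n t)
      (fun j => (hmeas F).sub (hmeas _)) _ ?_).trans ?_
    · filter_upwards [hS t] with ω hω
      exact hω.const_sub _
    · refine (liminf_le_liminf (v := fun _ => ENNReal.ofReal
        (K * Real.sqrt (∑' n : {n // n ∉ F}, w n * ‖c n‖ ^ 2))) ?_).trans (by simp)
      filter_upwards [tendsto_freqBox.eventually (eventually_ge_atTop F)] with j hj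
      have heq : (fun ω => (∑ n ∈ F, c n * ξ n ω * fourier n t)
          - ∑ n ∈ freqBox j, c n * ξ n ω * fourier n t)
          = -fun ω => ∑ n ∈ freqBox j \ F, c n * fourier n t * ξ n ω := by
        ext ω
        rw [Pi.neg_apply, ← hcomm, ← Finset.sum_sdiff hj]
        ring
      rw [heq, eLpNorm_neg]
      refine (hB.eLpNorm_fourier_le _ c t).trans (ENNReal.ofReal_le_ofReal ?_)
      refine mul_le_mul_of_nonneg_left (Real.sqrt_le_sqrt ?_) hK.le
      rw [← Finset.sum_subtype_of_mem (p := fun n => n ∉ F) _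
        fun n hn => (Finset.mem_sdiff.1 hn).2]
      exact (hc.subtype _).sum_le_tsum _ fun n _ => hv n
  refine ⟨?_, ?_⟩
  · have h1 := hbound ∅
    simp only [Finset.sum_empty, zero_sub] at h1
    refine ⟨hSm, ?_⟩
    have h2 : eLpNorm (S t) 2 P = eLpNorm (fun ω => -S t ω) 2 P := (eLpNorm_neg (S t) 2 P).symm
    rw [h2]
    exact h1.trans_lt ENNReal.ofReal_lt_top
  · refine tendsto_of_tendsto_of_tendsto_of_le_of_le tendsto_const_nhds ?_ (fun _ => zero_le)
      hbound
    have h1 := tendsto_tsum_compl_atTop_zero fun n => w n * ‖c n‖ ^ 2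
    have h2 := (ENNReal.continuous_ofReal.tendsto _).comp
      (((Real.continuous_sqrt.tendsto _).comp h1).const_mul K)
    simpa [Function.comp_def] using h2

theorem exists_isRandomFourierSum [IsProbabilityMeasure P] {γ : ℤ → ℂ} (hξ : IsStationaryGaussian P ξ γ) {b : ℝ}
    (hbdd : IsBoundedMatrix (weightedCovMatrix γ b)) {c : ℤ → ℂ} (hsum : entropySum c b < ∞) :
    ∃ S : UnitAddCircle → Ω → ℂ, IsRandomFourierSum P c ξ S ∧ AEBoundedPaths P S := by
  have hG := hξ.circular.gaussian
  have hcov : HasCovariance P ξ γ :=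
    ⟨fun n => (hG.hasGaussianLaw_eval n).memLp_two, hξ.circular.covariance⟩
  obtain ⟨K, hK, hB⟩ := hbdd.exists_eLpNorm_sum_le
  have hB' : HasWeightedBound P ξ (sobolevWeight b) K := hB hcov hξ.unit_variance
  obtain ⟨s, hs0, hs, hblock⟩ := exists_summable_block_bound hsum
  have hae := ae_summable_norm_trigPoly hG hξ.circular.mean_zero hK hB' c hs0 hs hblock
  set B : ℕ → Ω → C(UnitAddCircle, ℂ) := fun j ω =>
    trigPoly (freqBox (j + 1) \ freqBox j) fun n => c n * ξ n ω with hBdef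
  set B₀ : Ω → C(UnitAddCircle, ℂ) := fun ω => trigPoly (freqBox 0) fun n => c n * ξ n ω
  -- Summing the blocks pointwise gives one exceptional null set for all `t`; there the value of the
  -- sum is irrelevant.
  refine ⟨fun t ω => B₀ ω t + ∑' j, B j ω t, ?_, ?_⟩
  · refine isRandomFourierSum_of_ae_tendsto hcov (fun n => (sobolevWeight_pos b n).le) hK hB'
      (summable_sobolevWeight hsum) fun t => ?_
    filter_upwards [hae] with ω hω
    have h1 : Summable fun j => B j ω t :=
      Summable.of_norm_bounded hω fun j => ContinuousMap.norm_coe_le_norm _ t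
    refine (h1.hasSum.tendsto_sum_nat.const_add (B₀ ω t)).congr fun J => ?_
    induction J with
    | zero => simp [B₀, trigPoly_apply]
    | succ J ih =>
      rw [Finset.sum_range_succ, ← add_assoc, ih, ← Finset.sum_sdiff (freqBox_mono J.le_succ),
        hBdef, add_comm]
      simp only [trigPoly_apply]
  · filter_upwards [hae] with ω hω
    refine ⟨‖B₀ ω‖ + ∑' j, ‖B j ω‖, fun t => (norm_add_le _ _).trans (add_le_add
      (ContinuousMap.norm_coe_le_norm _ t) (tsum_of_norm_bounded hω.hasSum fun j =>
        ContinuousMap.norm_coe_le_norm _ t))⟩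

end RandomSeries

/-! ### Gaussian processes under `L²` limits -/

section GaussianLimit

variable {Ω ι : Type*} [MeasurableSpace Ω] {P : Measure Ω} {l : Filter ι}

lemma tendsto_integral_mul_conj {X Y : ι → Ω → ℂ} {X₀ Y₀ : Ω → ℂ}
    (hX : ∀ i, MemLp (X i) 2 P) (hY : ∀ i, MemLp (Y i) 2 P) (hX₀ : MemLp X₀ 2 P)
    (hY₀ : MemLp Y₀ 2 P) (hXl : Tendsto (fun i => eLpNorm (X i - X₀) 2 P) l (𝓝 0))
    (hYl : Tendsto (fun i => eLpNorm (Y i - Y₀) 2 P) l (𝓝 0)) :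
    Tendsto (fun i => ∫ ω, X i ω * conj (Y i ω) ∂P) l (𝓝 (∫ ω, X₀ ω * conj (Y₀ ω) ∂P)) := by
  have hinner : ∀ {U V : Ω → ℂ} (hU : MemLp U 2 P) (hV : MemLp V 2 P),
      ∫ ω, U ω * conj (V ω) ∂P = inner ℂ (hV.toLp V) (hU.toLp U) := by
    intro U V hU hV
    rw [L2.inner_def]
    refine integral_congr_ae ?_
    filter_upwards [hU.coeFn_toLp, hV.coeFn_toLp] with ω h1 h2
    rw [h1, h2, RCLike.inner_apply]
  have h1 := (Lp.tendsto_Lp_iff_tendsto_eLpNorm'' X hX X₀ hX₀).2 hXl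
  have h2 := (Lp.tendsto_Lp_iff_tendsto_eLpNorm'' Y hY Y₀ hY₀).2 hYl
  rw [hinner hX₀ hY₀]
  simp_rw [fun i => hinner (hX i) (hY i)]
  exact h2.inner h1

lemma tendsto_integral_of_tendsto_eLpNorm_two [IsProbabilityMeasure P] {E : Type*}
    [NormedAddCommGroup E] [NormedSpace ℝ E] [CompleteSpace E] {X : ι → Ω → E} {X₀ : Ω → E}
    (hX : ∀ i, MemLp (X i) 2 P) (hX₀ : MemLp X₀ 2 P)
    (hl : Tendsto (fun i => eLpNorm (X i - X₀) 2 P) l (𝓝 0)) :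
    Tendsto (fun i => ∫ ω, X i ω ∂P) l (𝓝 (∫ ω, X₀ ω ∂P)) := by
  refine tendsto_integral_of_L1' _ (hX₀.integrable (by norm_num)).aestronglyMeasurable
    (Eventually.of_forall fun i => (hX i).integrable (by norm_num)) ?_
  exact tendsto_of_tendsto_of_tendsto_of_le_of_le tendsto_const_nhds hl (fun _ => zero_le)
    fun i => eLpNorm_le_eLpNorm_of_exponent_le (by norm_num)
      ((hX i).sub hX₀).aestronglyMeasurable

/-- Mean, variance and `E exp (i Y)` are all continuous for `L²` convergence. The argument `1` of
the characteristic function suffices, because the lemma is applied to every continuous linear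
functional of the process. -/
lemma integral_exp_eq_of_tendsto_gaussian [IsProbabilityMeasure P] [l.NeBot] {Y : ι → Ω → ℝ}
    {Y₀ : Ω → ℝ} (hY : ∀ i, HasGaussianLaw (Y i) P) (hY₀ : MemLp Y₀ 2 P)
    (hl : Tendsto (fun i => eLpNorm (Y i - Y₀) 2 P) l (𝓝 0)) :
    ∫ ω, Complex.exp (Y₀ ω * Complex.I) ∂P
      = Complex.exp ((∫ ω, Y₀ ω ∂P : ℝ) * Complex.I - Var[Y₀; P] / 2) := by
  have hY2 : ∀ i, MemLp (Y i) 2 P := fun i => (hY i).memLp_two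
  have hmean := tendsto_integral_of_tendsto_eLpNorm_two hY2 hY₀ hl
  have hsq : Tendsto (fun i => ∫ ω, Y i ω ^ 2 ∂P) l (𝓝 (∫ ω, Y₀ ω ^ 2 ∂P)) := by
    have hinner : ∀ {U : Ω → ℝ} (hU : MemLp U 2 P),
        ∫ ω, U ω ^ 2 ∂P = ‖hU.toLp U‖ ^ 2 := by
      intro U hU
      rw [← real_inner_self_eq_norm_sq, L2.inner_def]
      refine integral_congr_ae ?_
      filter_upwards [hU.coeFn_toLp] with ω h1
      rw [h1, real_inner_self_eq_norm_sq, Real.norm_eq_abs, sq_abs]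
    have h1 := (Lp.tendsto_Lp_iff_tendsto_eLpNorm'' Y hY2 Y₀ hY₀).2 hl
    rw [hinner hY₀]
    simp_rw [fun i => hinner (hY2 i)]
    exact h1.norm.pow 2
  have hvar : Tendsto (fun i => Var[Y i; P]) l (𝓝 Var[Y₀; P]) := by
    rw [variance_eq_sub hY₀]
    simp_rw [fun i => variance_eq_sub (hY2 i)]
    exact hsq.sub (hmean.pow 2)
  have hexpm : ∀ {U : Ω → ℝ}, MemLp U 2 P → MemLp (fun ω => Complex.exp (U ω * Complex.I)) 2 P := by
    intro U hU
    refine MemLp.of_bound ?_ 1 (ae_of_all _ fun ω => (Complex.norm_exp_ofReal_mul_I _).le)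
    have : Continuous fun x : ℝ => Complex.exp (x * Complex.I) := by fun_prop
    exact this.comp_aestronglyMeasurable hU.aestronglyMeasurable
  have hexp : Tendsto (fun i => ∫ ω, Complex.exp (Y i ω * Complex.I) ∂P) l
      (𝓝 (∫ ω, Complex.exp (Y₀ ω * Complex.I) ∂P)) := by
    refine tendsto_integral_of_tendsto_eLpNorm_two (fun i => hexpm (hY2 i)) (hexpm hY₀) ?_
    refine tendsto_of_tendsto_of_tendsto_of_le_of_le tendsto_const_nhds hl (fun _ => zero_le)
      fun i => eLpNorm_mono fun ω => ?_
    have h1 : Complex.exp (Y i ω * Complex.I) - Complex.exp (Y₀ ω * Complex.I)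
        = Complex.exp (Y₀ ω * Complex.I)
          * (Complex.exp (Complex.I * ((Y i ω - Y₀ ω : ℝ) : ℂ)) - 1) := by
      rw [mul_sub, mul_one, ← Complex.exp_add]
      congr 2
      push_cast
      ring
    simp only [Pi.sub_apply]
    rw [h1, norm_mul, Complex.norm_exp_ofReal_mul_I, one_mul]
    exact Real.norm_exp_I_mul_ofReal_sub_one_le
  have hgauss : ∀ i, ∫ ω, Complex.exp (Y i ω * Complex.I) ∂P
      = Complex.exp ((∫ ω, Y i ω ∂P : ℝ) * Complex.I - Var[Y i; P] / 2) := by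
    intro i
    have h1 := (hY i).charFunDual_map_eq (ContinuousLinearMap.id ℝ ℝ)
    rw [charFunDual_apply, integral_map (hY i).aemeasurable (by fun_prop)] at h1
    exact h1
  refine tendsto_nhds_unique hexp ?_
  simp_rw [hgauss]
  have hcont : Continuous fun p : ℝ × ℝ => Complex.exp ((p.1 : ℂ) * Complex.I - p.2 / 2) := by
    fun_prop
  exact (hcont.tendsto _).comp (hmean.prodMk_nhds hvar)

lemma isGaussianProcess_of_tendsto_eLpNorm [IsProbabilityMeasure P] [l.NeBot] {T : Type*}
    {X : ι → T → Ω → ℂ} {Y : T → Ω → ℂ} (hX : ∀ i, IsGaussianProcess (X i) P)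
    (hY : ∀ t, MemLp (Y t) 2 P)
    (hl : ∀ t, Tendsto (fun i => eLpNorm (X i t - Y t) 2 P) l (𝓝 0)) :
    IsGaussianProcess Y P where
  hasGaussianLaw I := by
    have hmeas : AEMeasurable (fun ω => I.restrict (Y · ω)) P :=
      aemeasurable_pi_lambda _ fun t => (hY t).aestronglyMeasurable.aemeasurable
    refine (hasGaussianLaw_iff_charFunDual_map_eq hmeas).2 fun L => ?_
    rw [charFunDual_apply, integral_map hmeas (by fun_prop)]
    have hLm : MemLp (fun ω => I.restrict (Y · ω)) 2 P := MemLp.of_eval fun t => hY t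
    refine integral_exp_eq_of_tendsto_gaussian (l := l)
      (Y := fun i ω => L (I.restrict (X i · ω)))
      (fun i => ((hX i).hasGaussianLaw I).map_fun L) (L.comp_memLp' hLm) ?_
    have hsum : Tendsto (fun i => ENNReal.ofReal ‖L‖ * ∑ t : I, eLpNorm (X i t - Y t) 2 P) l
        (𝓝 0) := by
      have h1 := tendsto_finsetSum Finset.univ fun (t : I) _ => hl t
      have h2 := ENNReal.Tendsto.const_mul h1 (Or.inr (ENNReal.ofReal_ne_top (r := ‖L‖)))
      simpa using h2
    refine tendsto_of_tendsto_of_tendsto_of_le_of_le tendsto_const_nhds hsum (fun _ => zero_le)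
      fun i => ?_
    have hm : ∀ t, AEStronglyMeasurable (X i t - Y t) P := fun t =>
      (((hX i).hasGaussianLaw_eval t).memLp_two.sub (hY t)).aestronglyMeasurable
    have hnorm : eLpNorm (∑ t : I, fun ω => ‖(X i t - Y t) ω‖) 2 P
        ≤ ∑ t : I, eLpNorm (X i t - Y t) 2 P := by
      refine (eLpNorm_sum_le (f := fun (t : I) ω => ‖(X i t - Y t) ω‖)
        (fun t _ => (hm t).norm) (by norm_num)).trans (le_of_eq ?_)
      exact Finset.sum_congr rfl fun t _ => eLpNorm_norm (X i t - Y t)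
    calc _ ≤ ENNReal.ofReal ‖L‖ * eLpNorm (∑ t : I, fun ω => ‖(X i t - Y t) ω‖) 2 P := by
          refine eLpNorm_le_mul_eLpNorm_of_ae_le_mul (ae_of_all _ fun ω => ?_) 2
          simp only [Pi.sub_apply, ← map_sub]
          refine (L.le_opNorm _).trans (mul_le_mul_of_nonneg_left ?_ (norm_nonneg _))
          refine (pi_norm_le_iff_of_nonneg (norm_nonneg _)).2 fun t => ?_
          rw [Finset.sum_apply, Real.norm_of_nonneg (Finset.sum_nonneg fun t _ => norm_nonneg _)]
          exact Finset.single_le_sum (f := fun t : I => ‖X i t ω - Y t ω‖)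
            (fun t _ => norm_nonneg _) (Finset.mem_univ t)
      _ ≤ ENNReal.ofReal ‖L‖ * ∑ t : I, eLpNorm (X i t - Y t) 2 P := by
          gcongr

end GaussianLimit

/-- Gaussianity and the moments pass to the limit from the partial sums. The covariance is left as
an arbitrary limit `D`, to be identified through the spectral measure. -/
lemma IsRandomFourierSum.isCircularGaussian {Ω : Type*} [MeasurableSpace Ω] {P : Measure Ω}
    [IsProbabilityMeasure P] {ξ : ℤ → Ω → ℂ} {γ : ℤ → ℂ}
    (hξ : IsCircularGaussian P ξ fun n m => γ (n - m)) {c : ℤ → ℂ} {S : UnitAddCircle → Ω → ℂ}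
    (hS : IsRandomFourierSum P c ξ S) {D : UnitAddCircle → UnitAddCircle → ℂ}
    (hD : ∀ t s, Tendsto (fun F : Finset ℤ => ∑ n ∈ F, ∑ m ∈ F,
      c n * fourier n t * conj (c m * fourier m s) * γ (n - m)) atTop (𝓝 (D t s))) :
    IsCircularGaussian P S D := by
  have hG := hξ.gaussian
  have hm : ∀ n, MemLp (ξ n) 2 P := fun n => (hG.hasGaussianLaw_eval n).memLp_two
  set X : Finset ℤ → UnitAddCircle → Ω → ℂ :=
    fun F t ω => ∑ n ∈ F, c n * fourier n t * ξ n ω with hX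
  have hXm : ∀ t F, MemLp (X F t) 2 P := fun t F =>
    memLp_finsetSum F fun n _ => (hm n).const_mul (c n * fourier n t)
  have hl : ∀ t, Tendsto (fun F => eLpNorm (X F t - S t) 2 P) atTop (𝓝 0) := by
    intro t
    refine (hS t).2.congr fun F => ?_
    congr 1
    ext ω
    simp only [hX, Pi.sub_apply]
    congr 1
    exact Finset.sum_congr rfl fun n _ => by ring
  have hSm : ∀ t, MemLp (S t) 2 P := fun t => (hS t).1
  refine ⟨isGaussianProcess_of_tendsto_eLpNorm (l := atTop) (X := X) (fun F => ?_) hSm hl,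
    fun t => ?_, fun t s => ?_, fun t s => ?_⟩
  · refine hG.of_isGaussianProcess fun t => ⟨F, ∑ n : F,
      (ContinuousLinearMap.mul ℝ ℂ (c n * fourier (n : ℤ) t)).comp
        (ContinuousLinearMap.proj (R := ℝ) (φ := fun _ : F => ℂ) n), fun ω => ?_⟩
    simp only [hX, _root_.sum_apply, ContinuousLinearMap.comp_apply,
      ContinuousLinearMap.proj_apply, ContinuousLinearMap.mul_apply', Finset.restrict]
    exact (Finset.sum_coe_sort F fun n => c n * fourier n t * ξ n ω).symm
  · refine tendsto_nhds_unique
      (tendsto_integral_of_tendsto_eLpNorm_two (hXm t) (hSm t) (hl t)) ?_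
    simp_rw [hX, integral_sum_mul_eq_zero hG hξ.mean_zero]
    exact tendsto_const_nhds
  -- `E (S t * S s)` is treated as the sesquilinear moment of `S t` and the conjugate of `S s`.
  · have hsl : Tendsto (fun F => eLpNorm (star (X F s) - star (S s)) 2 P) atTop (𝓝 0) := by
      refine (hl s).congr fun F => eLpNorm_congr_norm_ae (ae_of_all _ fun ω => ?_)
      rw [← star_sub, Pi.star_apply, norm_star]
    have h1 := tendsto_integral_mul_conj (hXm t) (fun F => (hXm s F).star) (hSm t) (hSm s).star
      (hl t) hsl
    simp only [Pi.star_apply, RCLike.star_def, RCLike.conj_conj] at h1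
    refine tendsto_nhds_unique h1 ?_
    have h2 : ∀ F, ∫ ω, X F t ω * X F s ω ∂P = 0 := by
      intro F
      have hint : ∀ n m, Integrable (fun ω => ξ n ω * ξ m ω) P := fun n m =>
        (hm n).integrable_mul (hm m)
      have h3 : ∀ ω, X F t ω * X F s ω = ∑ n ∈ F, ∑ m ∈ F,
          c n * fourier n t * (c m * fourier m s) * (ξ n ω * ξ m ω) := by
        intro ω
        rw [hX, Finset.sum_mul_sum]
        exact Finset.sum_congr rfl fun n _ => Finset.sum_congr rfl fun m _ => by ring
      simp_rw [h3]
      rw [integral_finsetSum _ fun n _ => integrable_finsetSum _ fun m _ =>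
        (hint n m).const_mul _]
      refine Finset.sum_eq_zero fun n _ => ?_
      rw [integral_finsetSum _ fun m _ => (hint n m).const_mul _]
      refine Finset.sum_eq_zero fun m _ => ?_
      rw [integral_const_mul, hξ.pseudo_zero, mul_zero]
    simp_rw [h2]
    exact tendsto_const_nhds
  · refine tendsto_nhds_unique
      (tendsto_integral_mul_conj (hXm t) (hXm s) (hSm t) (hSm s) (hl t) (hl s)) ?_
    refine (hD t s).congr fun F => ?_
    rw [hX, integral_sum_mul_conj_sum hm]
    simp_rw [hξ.covariance]

/-! ### Fourier series of translates in `L²(μ)` -/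

section SpectralConvergence

variable {μ : Measure UnitAddCircle}

lemma hasCovariance_fourier {γ : ℤ → ℂ} (h : IsSpectralMeasure μ γ) :
    HasCovariance μ (fun n => (fourier n : UnitAddCircle → ℂ)) γ := by
  have := h.1
  refine ⟨fun n => MemLp.of_bound (fourier n).continuous.aestronglyMeasurable 1
    (ae_of_all _ fun t => ?_), fun n m => ?_⟩
  · rw [fourier_apply, Circle.norm_coe]
  · rw [h.2, sub_eq_add_neg]
    refine integral_congr_ae (ae_of_all _ fun t => ?_)
    beta_reduce
    rw [fourier_add, fourier_neg]

lemma fourier_mul_eq_add (n : ℤ) (t u : UnitAddCircle) :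
    (fourier n t * fourier n u : ℂ) = fourier n (t + u) := by
  rw [fourier_apply, fourier_apply, fourier_apply, smul_add, toCircle_add, Circle.coe_mul]

variable [IsProbabilityMeasure μ]

lemma memLp_two_of_continuous {h : UnitAddCircle → ℂ} (hh : Continuous h) : MemLp h 2 μ := by
  obtain ⟨C, hC⟩ := isCompact_univ.exists_bound_of_continuousOn hh.continuousOn
  exact MemLp.of_bound hh.aestronglyMeasurable C (ae_of_all _ fun t => hC t trivial)

/-- Fubini and translation invariance: averaging the translates removes `μ`, which may be singular.
-/
lemma integral_integral_norm_sq_translate {h : UnitAddCircle → ℂ} (hh : Continuous h) :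
    ∫ t, ∫ u, ‖h (t + u)‖ ^ 2 ∂μ ∂haarAddCircle = ∫ t, ‖h t‖ ^ 2 ∂haarAddCircle := by
  have hc : Continuous (Function.uncurry fun t u : UnitAddCircle => ‖h (t + u)‖ ^ 2) := by
    simp only [Function.uncurry_def]
    fun_prop
  rw [integral_integral_swap
    (hc.integrable_of_hasCompactSupport (HasCompactSupport.of_compactSpace _))]
  have h1 : ∀ u : UnitAddCircle, ∫ t, ‖h (t + u)‖ ^ 2 ∂haarAddCircle
      = ∫ t, ‖h t‖ ^ 2 ∂haarAddCircle := fun u =>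
    integral_add_right_eq_self (fun t => ‖h t‖ ^ 2) u
  simp_rw [h1]
  simp

lemma continuous_sqrt_integral_norm_sq_translate {h : UnitAddCircle → ℂ} (hh : Continuous h) :
    Continuous fun t => Real.sqrt (∫ u, ‖h (t + u)‖ ^ 2 ∂μ) := by
  have hc : Continuous (Function.uncurry fun t u : UnitAddCircle => ‖h (t + u)‖ ^ 2) := by
    simp only [Function.uncurry_def]
    fun_prop
  have h1 := continuous_parametric_integral_of_continuous (μ := μ) hc isCompact_univ
  simp only [Measure.restrict_univ] at h1
  exact Real.continuous_sqrt.comp h1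

lemma tendsto_integral_norm_sq_fourier_sub {f : UnitAddCircle → ℂ} (hf : Continuous f) :
    Tendsto (fun F : Finset ℤ =>
      ∫ t, ‖∑ n ∈ F, fourierCoeff f n * fourier n t - f t‖ ^ 2 ∂haarAddCircle) atTop (𝓝 0) := by
  have hm : MemLp f 2 (haarAddCircle (T := (1 : ℝ))) := memLp_two_of_continuous hf
  have h1 : Tendsto (fun F : Finset ℤ => ∑ n ∈ F, fourierCoeff f n • fourierLp 2 n) atTop
      (𝓝 (hm.toLp f)) := by
    have h2 := hasSum_fourier_series_L2 (hm.toLp f)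
    rwa [fourierCoeff_congr_ae hm.coeFn_toLp] at h2
  have hsub : ∀ F : Finset ℤ,
      MemLp (fun t => ∑ n ∈ F, fourierCoeff f n * fourier n t - f t) 2
        (haarAddCircle (T := (1 : ℝ))) := fun F => memLp_two_of_continuous (by fun_prop)
  have h3 : ∀ F : Finset ℤ, ∫ t, ‖∑ n ∈ F, fourierCoeff f n * fourier n t - f t‖ ^ 2 ∂haarAddCircle
      = ‖∑ n ∈ F, fourierCoeff f n • fourierLp 2 n - hm.toLp f‖ ^ 2 := by
    intro F
    have h4 : ∑ n ∈ F, fourierCoeff f n • fourierLp 2 n - hm.toLp f = (hsub F).toLp _ := by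
      have h5 : ∑ n ∈ F, fourierCoeff f n • fourierLp (T := 1) 2 n
          = ContinuousMap.toLp (E := ℂ) 2 haarAddCircle ℂ (trigPoly F (fourierCoeff f)) := by
        rw [trigPoly, map_sum]
        simp_rw [map_smul]
      rw [h5]
      refine Lp.ext ?_
      filter_upwards [Lp.coeFn_sub (ContinuousMap.toLp (E := ℂ) 2 haarAddCircle ℂ
        (trigPoly F (fourierCoeff f))) (hm.toLp f), hm.coeFn_toLp, (hsub F).coeFn_toLp,
        ContinuousMap.coeFn_toLp (𝕜 := ℂ) (p := 2) haarAddCircle (trigPoly F (fourierCoeff f))]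
        with t e1 e2 e3 e4
      rw [e1, e3, Pi.sub_apply, e2, e4, trigPoly_apply]
    rw [h4, Lp.norm_toLp, eLpNorm_two_eq_ofReal_sqrt (hsub F),
      ENNReal.toReal_ofReal (Real.sqrt_nonneg _),
      Real.sq_sqrt (integral_nonneg fun t => by positivity)]
  simp_rw [h3]
  have h6 := (tendsto_iff_norm_sub_tendsto_zero.1 h1).pow 2
  simpa using h6

theorem tendsto_eLpNorm_fourier_translate {w : ℤ → ℝ} {K : ℝ} (hw : ∀ n, 0 ≤ w n) (hK : 0 < K)
    (hB : HasWeightedBound μ (fun n => (fourier n : UnitAddCircle → ℂ)) w K)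
    {f : UnitAddCircle → ℂ} (hf : Continuous f)
    (hc : Summable fun n => w n * ‖fourierCoeff f n‖ ^ 2) (t : UnitAddCircle) :
    Tendsto (fun F : Finset ℤ => eLpNorm ((fun u =>
      ∑ n ∈ F, fourierCoeff f n * fourier n t * fourier n u) - fun u => f (t + u)) 2 μ) atTop
      (𝓝 0) := by
  set c := fourierCoeff f with hcdef
  have hv : ∀ n, 0 ≤ w n * ‖c n‖ ^ 2 := fun n => mul_nonneg (hw n) (by positivity)
  set h : Finset ℤ → UnitAddCircle → ℂ := fun F t => ∑ n ∈ F, c n * fourier n t - f t with hh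
  have hcont : ∀ F, Continuous (h F) := fun F => by simp only [hh]; fun_prop
  have hmem : ∀ F t, MemLp (fun u => h F (t + u)) 2 μ := fun F t =>
    memLp_two_of_continuous ((hcont F).comp (by fun_prop))
  set e : Finset ℤ → UnitAddCircle → ℝ := fun F t => Real.sqrt (∫ u, ‖h F (t + u)‖ ^ 2 ∂μ) with he
  have hen : ∀ F t, eLpNorm (fun u => h F (t + u)) 2 μ = ENNReal.ofReal (e F t) := fun F t =>
    eLpNorm_two_eq_ofReal_sqrt (hmem F t)
  have he0 : ∀ F t, 0 ≤ e F t := fun F t => Real.sqrt_nonneg _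
  set τ : Finset ℤ → ℝ := fun F => K * Real.sqrt (∑' n : {n // n ∉ F}, w n * ‖c n‖ ^ 2) with hτ
  have hτ0 : ∀ F, 0 ≤ τ F := fun F => by positivity
  -- The sums over `F` and `G` differ by frequencies outside `F`, so the weighted bound gives `τ F`,
  -- independent of `t` and `G`.
  have hcauchy : ∀ F G, F ⊆ G → ∀ t, e F t ≤ τ F + e G t := by
    intro F G hFG t
    have h1 : (fun u => h F (t + u)) = (fun u => h G (t + u))
        - fun u => ∑ n ∈ G \ F, c n * fourier n t * fourier n u := by
      ext u
      simp only [hh, Pi.sub_apply]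
      rw [← Finset.sum_sdiff hFG]
      simp_rw [mul_assoc, fun n : ℤ => fourier_mul_eq_add n t u]
      ring
    have h2 : ENNReal.ofReal (e F t) ≤ ENNReal.ofReal (τ F + e G t) := by
      rw [← hen, h1, add_comm, ENNReal.ofReal_add (he0 G t) (hτ0 F), ← hen]
      refine (eLpNorm_sub_le (hmem G t).aestronglyMeasurable (by
        refine Continuous.aestronglyMeasurable ?_
        fun_prop) (by norm_num)).trans (add_le_add le_rfl ?_)
      refine (hB.eLpNorm_fourier_le _ c t).trans (ENNReal.ofReal_le_ofReal ?_)
      refine mul_le_mul_of_nonneg_left (Real.sqrt_le_sqrt ?_) hK.le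
      rw [← Finset.sum_subtype_of_mem (p := fun n => n ∉ F) _
        fun n hn => (Finset.mem_sdiff.1 hn).2]
      exact (hc.subtype _).sum_le_tsum _ fun n _ => hv n
    exact (ENNReal.ofReal_le_ofReal_iff (add_nonneg (hτ0 F) (he0 G t))).1 h2
  have hecont : ∀ F, Continuous (e F) := fun F =>
    continuous_sqrt_integral_norm_sq_translate (hcont F)
  have hint : ∀ {g : UnitAddCircle → ℝ}, Continuous g → Integrable g haarAddCircle := fun hg =>
    hg.integrable_of_hasCompactSupport (HasCompactSupport.of_compactSpace _)
  have hlim : Tendsto (fun G => ∫ t, e G t ^ 2 ∂haarAddCircle) atTop (𝓝 0) := by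
    refine (tendsto_integral_norm_sq_fourier_sub hf).congr fun G => ?_
    rw [← integral_integral_norm_sq_translate (μ := μ) (hcont G)]
    refine integral_congr_ae (ae_of_all _ fun t => ?_)
    exact (Real.sq_sqrt (integral_nonneg fun u => by positivity)).symm
  -- The positive part of `e F - τ F` is at most `e G`, whose mean square over the circle tends to
  -- `0`. It therefore vanishes almost everywhere, and everywhere by continuity.
  have hbound : ∀ F t, e F t ≤ τ F := by
    intro F
    have hgc : Continuous fun t => max (e F t - τ F) 0 ^ 2 :=
      ((((hecont F).sub continuous_const)).max continuous_const).pow 2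
    have hle : ∫ t, max (e F t - τ F) 0 ^ 2 ∂haarAddCircle ≤ 0 := by
      refine ge_of_tendsto hlim ?_
      filter_upwards [eventually_ge_atTop F] with G hG
      refine integral_mono (hint hgc) (hint ((hecont G).pow 2)) fun t => ?_
      exact pow_le_pow_left₀ (le_max_right _ _)
        (max_le (by linarith [hcauchy F G hG t]) (he0 G t)) 2
    have hzero := (integral_eq_zero_iff_of_nonneg (fun t => by positivity) (hint hgc)).1
      (le_antisymm hle (integral_nonneg fun t => by positivity))
    have hall := (Continuous.ae_eq_iff_eq haarAddCircle hgc continuous_const).1 hzero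
    intro t
    have h1 : max (e F t - τ F) 0 ^ 2 = 0 := congrFun hall t
    have h2 := pow_eq_zero_iff (two_ne_zero) |>.1 h1
    linarith [le_max_left (e F t - τ F) 0]
  have hτlim : Tendsto (fun F => ENNReal.ofReal (τ F)) atTop (𝓝 0) := by
    have h1 := tendsto_tsum_compl_atTop_zero fun n => w n * ‖c n‖ ^ 2
    have h2 := (ENNReal.continuous_ofReal.tendsto _).comp
      (((Real.continuous_sqrt.tendsto _).comp h1).const_mul K)
    simpa [Function.comp_def] using h2
  refine tendsto_of_tendsto_of_tendsto_of_le_of_le tendsto_const_nhds hτlim (fun _ => zero_le)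
    fun F => ?_
  have h1 : ((fun u => ∑ n ∈ F, c n * fourier n t * fourier n u) - fun u => f (t + u))
      = fun u => h F (t + u) := by
    ext u
    simp only [hh, Pi.sub_apply]
    simp_rw [mul_assoc, fun n : ℤ => fourier_mul_eq_add n t u]
  rw [h1, hen]
  exact ENNReal.ofReal_le_ofReal (hbound F t)

end SpectralConvergence

/-- The coordinate process on `ℤ → ℂ` under the law of a stationary Gaussian sequence. -/
lemma IsStationaryGaussian.map_coordinates {Ω : Type*} [MeasurableSpace Ω] {P : Measure Ω}
    {ξ : ℤ → Ω → ℂ} {γ : ℤ → ℂ} (hξ : IsStationaryGaussian P ξ γ) :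
    IsStationaryGaussian (P.map fun ω n => ξ n ω) (fun n (x : ℤ → ℂ) => x n) γ := by
  have hG := hξ.circular.gaussian
  have hm : AEMeasurable (fun ω n => ξ n ω) P := aemeasurable_pi_lambda _ hG.aemeasurable
  have hint : ∀ {g : (ℤ → ℂ) → ℂ}, Measurable g →
      ∫ x, g x ∂(P.map fun ω n => ξ n ω) = ∫ ω, g (fun n => ξ n ω) ∂P := fun hg =>
    integral_map hm hg.aestronglyMeasurable
  refine ⟨⟨⟨fun I => ⟨?_⟩⟩, fun n => ?_, fun n m => ?_, fun n m => ?_⟩, hξ.unit_variance⟩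
  · have hr : Measurable fun x : ℤ → ℂ => I.restrict x := by fun_prop
    have h1 : (P.map fun ω n => ξ n ω).map (fun x : ℤ → ℂ => I.restrict x)
        = P.map fun ω => I.restrict (ξ · ω) := AEMeasurable.map_map_of_aemeasurable hr.aemeasurable hm
    have h2 := (hG.hasGaussianLaw I).isGaussian_map
    rw [← h1] at h2
    exact h2
  · rw [hint (by fun_prop)]
    exact hξ.circular.mean_zero n
  · rw [hint (by fun_prop)]
    exact hξ.circular.pseudo_zero n m
  · rw [hint (by fun_prop)]
    exact hξ.circular.covariance n m

theorem theorem4 {Ω : Type*} [MeasurableSpace Ω] (P : Measure Ω) [IsProbabilityMeasure P]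
    (ξ : ℤ → Ω → ℂ) (γ : ℤ → ℂ) (hξ : IsStationaryGaussian P ξ γ)
    (b : ℝ) (hb : 0 ≤ b) (hbdd : IsBoundedMatrix (weightedCovMatrix γ b))
    (f : UnitAddCircle → ℂ) (hf : MemLp f 2 haarAddCircle)
    (hsum : entropySum (fourierCoeff f) b < ∞) :
    (∃ S : UnitAddCircle → Ω → ℂ,
      IsRandomFourierSum P (fourierCoeff f) ξ S ∧ AEBoundedPaths P S) ∧
    (∀ (hc : Continuous f) (μ : Measure UnitAddCircle), IsSpectralMeasure μ γ →
      (⟨f, hc⟩ : C(UnitAddCircle, ℂ)) ∈ PisierClass μ) := by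
  refine ⟨exists_isRandomFourierSum hξ hbdd hsum, fun hc μ hμ => ?_⟩
  have hμP := hμ.1
  -- `PisierClass` asks for a sample space in `Type`, so the sequence is moved to its canonical
  -- space `ℤ → ℂ`.
  have hm : AEMeasurable (fun ω n => ξ n ω) P :=
    aemeasurable_pi_lambda _ hξ.circular.gaussian.aemeasurable
  have hP := Measure.isProbabilityMeasure_map hm
  have hξ' := hξ.map_coordinates
  obtain ⟨S, hS, hbd⟩ := exists_isRandomFourierSum hξ' hbdd hsum
  refine ⟨ℤ → ℂ, inferInstance, _, S, hS.isCircularGaussian hξ'.circular fun t s => ?_, hbd⟩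
  have hcov := hasCovariance_fourier hμ
  obtain ⟨K, hK, hB⟩ := hbdd.exists_eLpNorm_sum_le
  have hlim := tendsto_eLpNorm_fourier_translate (fun n => (sobolevWeight_pos b n).le) hK
    (hB hcov hξ.unit_variance) hc (summable_sobolevWeight hsum)
  -- The double sum with `γ (n - m)` is the `L²(μ)` inner product of the partial Fourier sums of two
  -- translates of `f`, so it tends to the covariance of `X_f`.
  refine (tendsto_integral_mul_conj (fun F => hcov.memLp_sum F _) (fun F => hcov.memLp_sum F _)
    (memLp_two_of_continuous (by fun_prop)) (memLp_two_of_continuous (by fun_prop))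
    (hlim t) (hlim s)).congr fun F => ?_
  rw [integral_sum_mul_conj_sum hcov.memLp]
  simp_rw [hcov.cov]
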